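/- Let $n\ge 3$, let $\mathbf B^n=\{x\in\mathbb R^n:\|x\|<1\}$ be the open unit ball and $\mathbb S^{n-1}$ the unit sphere. For $a\in\mathbf B^n$ let $u_a:\mathbf B^n\setminus\{a\}\to\mathbb S^{n-1}$ be the radial projection from $a$: $u_a(x)=a+\lambda_a(x)(x-a)$, where $\lambda_a(x)>0$ is the unique positive number with $u_a(x)\in\mathbb S^{n-1}$, that is, $u_a(x)$ is the point where the half-line of origin $a$ through $x$ meets $\mathbb S^{n-1}$; in particular $u_0(x)=x/\|x\|$. For $\alpha\in\mathbb R$ put $$E_{2,r^\alpha}(u)=\int_{\mathbf B^n}\|x\|^\alpha\,\|\nabla u(x)\|^2\,dx\in[0,\infty],\qquad \|\nabla u\|^2=\sum_{i=1}^n\|du(e_i)\|^2,$$ where $(e_i)$ is the standard basis of $\mathbb R^n$. (i) For every $a\in\mathbf B^n$ with $a\neq 0$ there exists $\alpha_0\in(2-n,0)$ such that for every $\alpha\in(2-n,\alpha_0]$, $$E_{2,r^\alpha}(u_a)<E_{2,r^\alpha}(u_0).$$ (ii) If $n\ge 6$, there exists $\alpha_0\in(4-n,5-n)$ such that for every $\alpha\in(4-n,\alpha_0)$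 there exists $a\in\mathbf B^n$ with $$E_{2,r^\alpha}(u_a)<E_{2,r^\alpha}(u_0).$$ -/

import Mathlib

/-- `n`-dimensional Euclidean space. -/
abbrev Euc (n : ℕ) : Type := EuclideanSpace ℝ (Fin n)

/-- `Δ_a(x) = (1 - ‖a‖²) ‖x - a‖² + ⟨a, x - a⟩²`. -/
noncomputable def discr {n : ℕ} (a x : Euc n) : ℝ :=
  (1 - ‖a‖ ^ 2) * ‖x - a‖ ^ 2 + (inner ℝ a (x - a)) ^ 2

/-- `λ_a(x)`: for `‖a‖ < 1` and `x ≠ a`, the unique positive `t` such that `a + t (x - a)` is on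
the unit sphere (see `scale_spec`). -/
noncomputable def scale {n : ℕ} (a x : Euc n) : ℝ :=
  (Real.sqrt (discr a x) - inner ℝ a (x - a)) / ‖x - a‖ ^ 2

/-- The radial projection `u_a` from the point `a` onto the unit sphere: `u_a(x)` is the point where
the half-line of origin `a` passing through `x` meets the unit sphere. -/
noncomputable def radialProj {n : ℕ} (a x : Euc n) : Euc n :=
  a + scale a x • (x - a)

/-- `‖∇u(x)‖² = ∑ᵢ ‖du(x) eᵢ‖²`, the squared Euclidean (Hilbert–Schmidt) norm of the
differential. The maps `u_a`, `‖a‖ < 1`, are smooth on the open ball away from `a`. -/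
noncomputable def gradNormSq {n : ℕ} (u : Euc n → Euc n) (x : Euc n) : ℝ :=
  ∑ i : Fin n, ‖fderiv ℝ u x (EuclideanSpace.single i 1)‖ ^ 2

/-- The weighted energy `E_{2,r^α}(u) = ∫_{B^n} r^α ‖∇u‖² dx`, `r = ‖x‖`, as an extended
nonnegative real number. -/
noncomputable def weightedEnergy {n : ℕ} (α : ℝ) (u : Euc n → Euc n) : ENNReal :=
  ∫⁻ x in Metric.ball (0 : Euc n) 1, ENNReal.ofReal (‖x‖ ^ α * gradNormSq u x)

/-- `radialProj a x` is the intersection point of the unit sphere with the half-line of origin `a`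
passing through `x`. -/
theorem scale_spec {n : ℕ} {a x : Euc n} (ha : ‖a‖ < 1) (hx : x ≠ a) :
    0 < scale a x ∧ ‖radialProj a x‖ = 1 ∧
      ∀ t : ℝ, 0 < t → ‖a + t • (x - a)‖ = 1 → t = scale a x := by
  have hv : 0 < ‖x - a‖ ^ 2 := by
    have : 0 < ‖x - a‖ := norm_pos_iff.mpr (sub_ne_zero.mpr hx)
    positivity
  have ha1 : 0 < 1 - ‖a‖ ^ 2 := by nlinarith [norm_nonneg a]
  set b : ℝ := inner ℝ a (x - a) with hb
  have hD : b ^ 2 < discr a x := by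
    have := mul_pos ha1 hv
    simp only [discr]
    linarith
  have hs : |b| < Real.sqrt (discr a x) := Real.lt_sqrt_of_sq_lt (by rwa [sq_abs])
  have hsq : Real.sqrt (discr a x) ^ 2 = discr a x := Real.sq_sqrt ((sq_nonneg b).trans hD.le)
  have hl : scale a x * ‖x - a‖ ^ 2 = Real.sqrt (discr a x) - b := by
    rw [scale, div_mul_cancel₀ _ hv.ne']
  have hexp : ∀ t : ℝ, ‖a + t • (x - a)‖ ^ 2 = ‖a‖ ^ 2 + 2 * (t * b) + t ^ 2 * ‖x - a‖ ^ 2 := by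
    intro t
    rw [norm_add_sq_real, inner_smul_right, norm_smul, mul_pow, Real.norm_eq_abs, sq_abs]
  have hpos : 0 < scale a x := div_pos (by linarith [le_abs_self b]) hv
  have key : ∀ t : ℝ, (‖a + t • (x - a)‖ ^ 2 - 1) * ‖x - a‖ ^ 2
      = (t * ‖x - a‖ ^ 2 + b) ^ 2 - discr a x := by
    intro t
    rw [hexp, discr, ← hb]
    ring
  refine ⟨hpos, ?_, ?_⟩
  · have h := key (scale a x)
    rw [hl, sub_add_cancel, hsq, sub_self] at h
    have h2 : ‖radialProj a x‖ ^ 2 = 1 := by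
      rcases mul_eq_zero.mp h with h | h
      · exact sub_eq_zero.mp h
      · exact absurd h hv.ne'
    exact (pow_eq_one_iff_of_nonneg (norm_nonneg _) two_ne_zero).mp h2
  · intro t ht h1
    have h := key t
    rw [h1] at h
    have h3 : (t * ‖x - a‖ ^ 2 + b) ^ 2 = Real.sqrt (discr a x) ^ 2 := by rw [hsq]; linarith
    have htv := mul_pos ht hv
    rcases sq_eq_sq_iff_eq_or_eq_neg.mp h3 with h4 | h4
    · have : t * ‖x - a‖ ^ 2 = scale a x * ‖x - a‖ ^ 2 := by rw [hl]; linarith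
      exact mul_right_cancel₀ hv.ne' this
    · linarith [neg_abs_le b]

/-- `u_0(x) = x / ‖x‖`. -/
theorem radialProj_zero {n : ℕ} (x : Euc n) : radialProj 0 x = ‖x‖⁻¹ • x := by
  by_cases hx : x = 0
  · simp [hx, radialProj]
  · have h : ‖x‖ ≠ 0 := norm_ne_zero_iff.mpr hx
    simp only [radialProj, scale, discr, sub_zero, norm_zero, inner_zero_left, zero_add]
    congr 1
    rw [show (1 - (0 : ℝ) ^ 2) * ‖x‖ ^ 2 + 0 ^ 2 = ‖x‖ ^ 2 by ring, Real.sqrt_sq (norm_nonneg x)]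
    field_simp

/-! Everything rests on an exact formula for `‖∇u_a‖²` (`gradNormSq_radialProj`), which gives
`(n-1)/‖x‖²` at `a = 0`. Hence `E(u_0) = |S|(n-1)/(α+n-2)`, where `|S|` is the area of the unit
sphere. This is continuous in `α > 2-n` and blows up at `2-n`. Moreover every energy is
nonincreasing in `α`, since `‖x‖ < 1`.

(i) For `a ≠ 0` the singularities of `‖x‖^(2-n)` and of `‖x-a‖^(-2)` are separated and each is
integrable. So the energy of `u_a` is finite already at `α = 2-n`, and by monotonicity it stays
bounded while that of `u_0` blows up.

(ii) At `α = 4-n`, average over the `2n` points `±t eᵢ`. To leading order `‖∇u_a‖²` is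
`(n-1)/‖x-a‖²`, plus a term odd in `a` that helps after pairing `±a`. The second-order part of the
sum is `t²Δ(‖x‖⁻²) = -(2n-8)t²‖x‖⁻⁴`, negative for `n > 4`. With weight `‖x‖^(4-n)` its integral
over `4t ≤ ‖x‖ < 1` is a multiple of `t² log(4t)`, while all errors, including the ball `‖x‖ < 4t`,
are `O(t²)`. For small `t` some vertex therefore beats the origin. Monotonicity and continuity carry
this to slightly larger `α` with the same `a`. -/

/-! ### Differential and gradient norm of the radial projection -/

theorem differentiableAt_scale {n : ℕ} {a x : Euc n} (ha : ‖a‖ < 1) (hx : x ≠ a) :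
    DifferentiableAt ℝ (scale a) x := by
  have hv : 0 < ‖x - a‖ ^ 2 := by
    have : 0 < ‖x - a‖ := norm_pos_iff.mpr (sub_ne_zero.mpr hx)
    positivity
  have hD : discr a x ≠ 0 := by
    have ha1 : 0 < 1 - ‖a‖ ^ 2 := by nlinarith [norm_nonneg a]
    have := mul_pos ha1 hv
    simp only [discr]
    positivity
  have h1 : DifferentiableAt ℝ (fun y : Euc n => ‖y - a‖ ^ 2) x :=
    (differentiableAt_id.sub_const a).norm_sq ℝ
  have h2 : DifferentiableAt ℝ (fun y : Euc n => (inner ℝ a (y - a) : ℝ)) x :=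
    (differentiableAt_const a).inner ℝ (differentiableAt_id.sub_const a)
  have h3 : DifferentiableAt ℝ (fun y : Euc n => discr a y) x := by
    unfold discr
    exact (h1.const_mul _).add (h2.pow 2)
  have h4 := ((h3.sqrt hD).sub h2).fun_mul (h1.inv hv.ne')
  exact h4

/-- The differential of the radial projection, in terms of its value. -/
theorem fderiv_radialProj {n : ℕ} {a x : Euc n} (ha : ‖a‖ < 1) (hx : x ≠ a) (v : Euc n) :
    fderiv ℝ (radialProj a) x v = scale a x •
      (v - ((inner ℝ (radialProj a x) v : ℝ) / (1 - inner ℝ a (radialProj a x))) •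
        (radialProj a x - a)) := by
  obtain ⟨hpos, hnorm, -⟩ := scale_spec ha hx
  have hsd := (differentiableAt_scale ha hx).hasFDerivAt
  set L := fderiv ℝ (scale a) x
  have hid : HasFDerivAt (fun y : Euc n => y - a) (ContinuousLinearMap.id ℝ (Euc n)) x :=
    (hasFDerivAt_id x).sub_const a
  have hu : HasFDerivAt (radialProj a)
      (scale a x • ContinuousLinearMap.id ℝ (Euc n) + L.smulRight (x - a)) x :=
    (hsd.smul hid).const_add a
  have huv : fderiv ℝ (radialProj a) x v = scale a x • v + L v • (x - a) := by
    rw [hu.fderiv]; simp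
  -- The derivative `L` of the scale factor is found implicitly, by differentiating `‖u‖² = 1` near
  -- `x`, instead of from its square-root formula.
  have hsq : HasFDerivAt (fun y => ‖radialProj a y‖ ^ 2) _ x := hu.norm_sq
  have hconst : (fun y => ‖radialProj a y‖ ^ 2) =ᶠ[nhds x] fun _ => (1 : ℝ) := by
    filter_upwards [isOpen_ne.mem_nhds hx] with y hy
    rw [(scale_spec ha hy).2.1, one_pow]
  have h0 := hsq.unique ((hasFDerivAt_const (1 : ℝ) x).congr_of_eventuallyEq hconst)
  have h0v := DFunLike.congr_fun h0 v
  simp only [smul_apply, ContinuousLinearMap.comp_apply,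
    add_apply, ContinuousLinearMap.smulRight_apply,
    ContinuousLinearMap.id_apply, innerSL_apply_apply, zero_apply,
    inner_add_right, inner_smul_right, nsmul_eq_mul] at h0v
  have hw : radialProj a x - a = scale a x • (x - a) := by simp [radialProj]
  have hau : (1 : ℝ) - inner ℝ a (radialProj a x) =
      scale a x * inner ℝ (radialProj a x) (x - a) := by
    rw [← inner_smul_right, ← hw, inner_sub_right, real_inner_self_eq_norm_sq, hnorm,
      real_inner_comm]
    ring
  have hlt : (inner ℝ a (radialProj a x) : ℝ) < 1 := by
    have := real_inner_le_norm a (radialProj a x)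
    rw [hnorm] at this
    linarith
  have hne : (inner ℝ (radialProj a x) (x - a) : ℝ) ≠ 0 := by
    intro h
    rw [h] at hau
    linarith
  have hL : L v = -(scale a x * (inner ℝ (radialProj a x) v /
      (scale a x * inner ℝ (radialProj a x) (x - a)) * scale a x)) := by
    field_simp
    push_cast at h0v
    linarith
  rw [huv, hau, hw, hL]
  module

/-- With `w = u - a` and `d = 1 - ⟨a, u⟩ = ⟨u, w⟩`, the differential is `scale a x` times the
rank-one perturbation `v ↦ v - (⟨u, v⟩/d) w` of the identity. Its squared Hilbert–Schmidt norm is `n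
- 2⟨u, w⟩/d + ‖u‖²‖w‖²/d²`. -/
theorem gradNormSq_radialProj {n : ℕ} {a x : Euc n} (ha : ‖a‖ < 1) (hx : x ≠ a) :
    gradNormSq (radialProj a) x = ‖radialProj a x - a‖ ^ 2 / ‖x - a‖ ^ 2 *
      (n - 2 + ‖radialProj a x - a‖ ^ 2 / (1 - inner ℝ a (radialProj a x)) ^ 2) := by
  obtain ⟨hpos, hnorm, -⟩ := scale_spec ha hx
  have hxa : 0 < ‖x - a‖ := norm_pos_iff.mpr (sub_ne_zero.mpr hx)
  have hw : ‖radialProj a x - a‖ = scale a x * ‖x - a‖ := by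
    simp [radialProj, norm_smul, abs_of_pos hpos]
  have hlt : (inner ℝ a (radialProj a x) : ℝ) < 1 := by
    have := real_inner_le_norm a (radialProj a x)
    rw [hnorm] at this
    linarith
  set u := radialProj a x with hu
  set d : ℝ := 1 - inner ℝ a u with hd
  have hd0 : d ≠ 0 := by simp only [hd]; linarith
  have hs : ‖u - a‖ ^ 2 / ‖x - a‖ ^ 2 = scale a x ^ 2 := by
    rw [hw]; field_simp
  have hterm : ∀ i : Fin n, ‖fderiv ℝ (radialProj a) x (EuclideanSpace.single i 1)‖ ^ 2 =
      scale a x ^ 2 * (1 - 2 / d * (u i * (u - a) i) + ‖u - a‖ ^ 2 / d ^ 2 * u i ^ 2) := by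
    intro i
    rw [fderiv_radialProj ha hx, ← hu, ← hd, norm_smul, mul_pow, Real.norm_eq_abs, sq_abs,
      norm_sub_sq_real, inner_smul_right, norm_smul, mul_pow, Real.norm_eq_abs, sq_abs]
    simp only [PiLp.norm_single, EuclideanSpace.inner_single_left,
      EuclideanSpace.inner_single_right, norm_one, map_one, conj_trivial]
    ring
  have hsum1 : ∑ i, u i * (u - a) i = d := by
    have : ∑ i, u i * (u - a) i = inner ℝ (u - a) u := by
      simp [PiLp.inner_apply]
    rw [this, inner_sub_left, real_inner_self_eq_norm_sq, hnorm]
    ring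
  have hsum2 : ∑ i, u i ^ 2 = 1 := by
    rw [← EuclideanSpace.real_norm_sq_eq, hnorm, one_pow]
  simp only [gradNormSq, hterm]
  rw [← Finset.mul_sum, Finset.sum_add_distrib, Finset.sum_sub_distrib, ← Finset.mul_sum,
    ← Finset.mul_sum, hsum1, hsum2, hs]
  simp only [Finset.sum_const, Finset.card_univ, Fintype.card_fin, nsmul_eq_mul, mul_one]
  rw [div_mul_cancel₀ _ hd0]

theorem measurable_gradNormSq {n : ℕ} (u : Euc n → Euc n) : Measurable (gradNormSq u) := by
  unfold gradNormSq
  exact Finset.measurable_sum _ fun i _ =>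
    ((measurable_fderiv_apply_const ℝ u _).norm).pow_const 2

theorem gradNormSq_nonneg {n : ℕ} (u : Euc n → Euc n) (x : Euc n) : 0 ≤ gradNormSq u x :=
  Finset.sum_nonneg fun _ _ => by positivity

theorem gradNormSq_radialProj_zero {n : ℕ} {x : Euc n} (hx : x ≠ 0) :
    gradNormSq (radialProj 0) x = (n - 1) / ‖x‖ ^ 2 := by
  rw [gradNormSq_radialProj (by simp) hx]
  have h : ‖radialProj (0 : Euc n) x‖ = 1 := (scale_spec (by simp) hx).2.1
  simp only [h, sub_zero, inner_zero_left]
  ring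

/-! ### Pointwise bounds for one projection -/

/-- Crude bound for the gradient of the radial projection. -/
theorem gradNormSq_radialProj_le {n : ℕ} (hn : 2 ≤ n) {a x : Euc n} (ha : ‖a‖ < 1) (hx : x ≠ a) :
    gradNormSq (radialProj a) x ≤ 4 * (n - 2 + 4 / (1 - ‖a‖) ^ 2) / ‖x - a‖ ^ 2 := by
  obtain ⟨hpos, hnorm, -⟩ := scale_spec ha hx
  have hxa : 0 < ‖x - a‖ := norm_pos_iff.mpr (sub_ne_zero.mpr hx)
  have hn' : (2 : ℝ) ≤ n := by exact_mod_cast hn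
  rw [gradNormSq_radialProj ha hx]
  set u := radialProj a x
  have h1 : ‖u - a‖ ^ 2 ≤ 4 := by
    have := norm_sub_le u a
    nlinarith [norm_nonneg (u - a)]
  have h2 : 1 - ‖a‖ ≤ 1 - inner ℝ a u := by
    have := real_inner_le_norm a u
    rw [hnorm] at this
    linarith
  have h3 : 0 < 1 - ‖a‖ := by linarith
  rw [div_mul_eq_mul_div]
  gcongr

/-- Refined bound for the gradient of the radial projection from a point near the origin. -/
theorem gradNormSq_radialProj_le_refined {n : ℕ} (hn : 2 ≤ n) {a x : Euc n} (ha : ‖a‖ ≤ 1 / 2)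
    (hx1 : ‖x‖ ≤ 1) (hx : x ≠ a) :
    gradNormSq (radialProj a) x ≤ (n - 1) * (1 / ‖x - a‖ ^ 2
        - 2 * inner ℝ a x / ‖x - a‖ ^ 3) + (12 * n + 24) * ‖a‖ ^ 2 / ‖x - a‖ ^ 3 := by
  have ha1 : ‖a‖ < 1 := by linarith
  obtain ⟨hpos, hnorm, -⟩ := scale_spec ha1 hx
  have hxa : 0 < ‖x - a‖ := norm_pos_iff.mpr (sub_ne_zero.mpr hx)
  have hn' : (2 : ℝ) ≤ n := by exact_mod_cast hn
  rw [gradNormSq_radialProj ha1 hx]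
  have hw : ‖radialProj a x - a‖ = scale a x * ‖x - a‖ := by
    simp [radialProj, norm_smul, abs_of_pos hpos]
  have hu : radialProj a x = a + scale a x • (x - a) := rfl
  set u := radialProj a x
  set s := scale a x
  set R := ‖x - a‖
  set t := ‖a‖
  set b : ℝ := inner ℝ a u
  have ht : 0 ≤ t := norm_nonneg a
  have hR : R ≤ 3 / 2 := (norm_sub_le x a).trans (by linarith)
  have hbt : |b| ≤ t := by
    have := abs_real_inner_le_norm a u
    rwa [hnorm, mul_one] at this
  have hbt' := abs_le.mp hbt
  have hw2 : ‖u - a‖ ^ 2 = 1 - 2 * b + t ^ 2 := by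
    rw [norm_sub_sq_real, hnorm, real_inner_comm]; ring
  -- Here `s * R = ‖u - a‖`, which differs from `‖u‖ = 1` by at most `‖a‖`.
  have hsR : |s * R - 1| ≤ t := by
    rw [← hw, ← hnorm]
    have := abs_norm_sub_norm_le (u - a) u
    simpa using this
  have hax : |inner ℝ a (x - a)| ≤ t * R := abs_real_inner_le_norm _ _
  -- `b` against the direction of `x - a`
  have hb : b = t ^ 2 + s * inner ℝ a (x - a) := by
    simp only [b, hu, inner_add_right, inner_smul_right, real_inner_self_eq_norm_sq]
    rfl
  have hb2 : inner ℝ a (x - a) / R - t ^ 2 ≤ b := by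
    have h1 : |(s * R - 1) * (inner ℝ a (x - a) / R)| ≤ t * t := by
      rw [abs_mul, abs_div, abs_of_pos hxa]
      have : |inner ℝ a (x - a)| / R ≤ t := by rwa [div_le_iff₀ hxa]
      gcongr
    have h2 : (s * R - 1) * (inner ℝ a (x - a) / R) =
        s * inner ℝ a (x - a) - inner ℝ a (x - a) / R := by field_simp
    rw [h2] at h1
    have := (abs_le.mp h1).1
    nlinarith [sq_nonneg t]
  have hinn : (inner ℝ a (x - a) : ℝ) = inner ℝ a x - t ^ 2 := by
    rw [inner_sub_right, real_inner_self_eq_norm_sq]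
  have hd : 1 / 2 ≤ 1 - b := by linarith
  -- The quotient equals `1 + (t² - b²)/(1 - b)²`: there is no first-order term, and `1 - b ≥ 1/2`.
  have hquot : ‖u - a‖ ^ 2 / (1 - b) ^ 2 ≤ 1 + 4 * t ^ 2 := by
    rw [hw2, div_le_iff₀ (by positivity)]
    nlinarith [sq_nonneg b, sq_nonneg t, mul_nonneg (sq_nonneg t) (sub_nonneg.mpr hd)]
  have hw4 : ‖u - a‖ ^ 2 ≤ 4 := by rw [hw2]; nlinarith
  have hw0 := sq_nonneg ‖u - a‖
  have hmain : ‖u - a‖ ^ 2 * (n - 2 + ‖u - a‖ ^ 2 / (1 - b) ^ 2) ≤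
      (n - 1) * (1 - 2 * (inner ℝ a x / R) + 2 * t ^ 2 / R) + (3 * n + 16) * t ^ 2 := by
    have e : 1 - 2 * b + t ^ 2 ≤ 1 - 2 * (inner ℝ a x / R) + 2 * t ^ 2 / R + 3 * t ^ 2 := by
      have : inner ℝ a (x - a) / R = inner ℝ a x / R - t ^ 2 / R := by rw [hinn, sub_div]
      rw [this] at hb2
      have h3 : 2 * t ^ 2 / R = 2 * (t ^ 2 / R) := by ring
      rw [h3]; linarith
    calc _ ≤ ‖u - a‖ ^ 2 * ((n - 1) + 4 * t ^ 2) := 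
            mul_le_mul_of_nonneg_left (by linarith) (sq_nonneg _)
      _ ≤ (n - 1) * ‖u - a‖ ^ 2 + 16 * t ^ 2 := by nlinarith [sq_nonneg t]
      _ ≤ _ := by
        rw [hw2]
        nlinarith [sq_nonneg t, mul_le_mul_of_nonneg_left e (by linarith : (0 : ℝ) ≤ n - 1)]
  calc _ = ‖u - a‖ ^ 2 * (n - 2 + ‖u - a‖ ^ 2 / (1 - b) ^ 2) / R ^ 2 := by ring
    _ ≤ ((n - 1) * (1 - 2 * (inner ℝ a x / R) + 2 * t ^ 2 / R) + (3 * n + 16) * t ^ 2) / R ^ 2 := by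
      gcongr
    _ = (n - 1) * (1 / R ^ 2 - 2 * inner ℝ a x / R ^ 3) +
        (2 * (n - 1) + (3 * n + 16) * R) * t ^ 2 / R ^ 3 := by
      field_simp
      ring
    _ ≤ _ := by
      have : 2 * (n - 1) + (3 * n + 16) * R ≤ (12 * n + 24 : ℝ) := by
        nlinarith [mul_nonneg (by linarith : (0 : ℝ) ≤ 3 * n + 16) (sub_nonneg.mpr hR)]
      gcongr

/-! ### Integrals of powers of the norm over balls and shells -/

open MeasureTheory Measure in
/-- Integration of a radial function in polar coordinates. -/
theorem lintegral_comp_norm {n : ℕ} (hn : 0 < n) {f : ℝ → ENNReal} (hf : Measurable f) :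
    ∫⁻ x : Euc n, f ‖x‖ = (n * volume (Metric.ball (0 : Euc n) 1)) *
      ∫⁻ r in Set.Ioi (0 : ℝ), ENNReal.ofReal (r ^ (n - 1)) * f r := by
  have : Nonempty (Fin n) := ⟨⟨0, hn⟩⟩
  have hmp := (volume : Measure (Euc n)).measurePreserving_homeomorphUnitSphereProd
  have hf2 : Measurable fun r : Set.Ioi (0 : ℝ) => f r.1 := hf.comp measurable_subtype_coe
  have hf3 : Measurable fun p : Metric.sphere (0 : Euc n) 1 × Set.Ioi (0 : ℝ) => f p.2.1 :=
    hf2.comp measurable_snd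
  calc ∫⁻ x : Euc n, f ‖x‖ = ∫⁻ x in ({0}ᶜ : Set (Euc n)), f ‖x‖ := by
        rw [restrict_compl_singleton]
    _ = ∫⁻ x : ({0}ᶜ : Set (Euc n)), f ‖x.1‖ ∂(volume.comap Subtype.val) :=
        (lintegral_subtype_comap (measurableSet_singleton _).compl fun x ↦ f ‖x‖).symm
    _ = ∫⁻ p, f p.2.1 ∂((volume : Measure (Euc n)).toSphere.prod
          (Measure.volumeIoiPow (Module.finrank ℝ (Euc n) - 1))) := by
        rw [← hmp.lintegral_comp hf3]
        simp
    _ = (volume : Measure (Euc n)).toSphere Set.univ *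
          ∫⁻ r, f r.1 ∂(Measure.volumeIoiPow (Module.finrank ℝ (Euc n) - 1)) := by
        rw [lintegral_prod _ hf3.aemeasurable]
        simp [mul_comm]
    _ = _ := by
        rw [Measure.toSphere_apply_univ, Measure.volumeIoiPow,
          lintegral_withDensity_eq_lintegral_mul _ (by fun_prop) hf2]
        simp only [finrank_euclideanSpace, Fintype.card_fin]
        congr 1
        exact lintegral_subtype_comap measurableSet_Ioi
          fun r : ℝ ↦ ENNReal.ofReal (r ^ (n - 1)) * f r

open MeasureTheory Measure in
theorem setLIntegral_norm_rpow {n : ℕ} (hn : 0 < n) {s : Set ℝ} (hs : MeasurableSet s)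
    (hs0 : s ⊆ Set.Ici 0) (p : ℝ) :
    ∫⁻ x in (norm ⁻¹' s : Set (Euc n)), ENNReal.ofReal (‖x‖ ^ p) =
      (n * volume (Metric.ball (0 : Euc n) 1)) *
        ∫⁻ r in s, ENNReal.ofReal (r ^ (p + n - 1)) := by
  have hm : Measurable fun r : ℝ => ENNReal.ofReal (r ^ p) := by fun_prop
  rw [← lintegral_indicator (measurable_norm hs),
    show ((norm ⁻¹' s : Set (Euc n)).indicator fun x => ENNReal.ofReal (‖x‖ ^ p)) =
      fun x => (s.indicator fun r => ENNReal.ofReal (r ^ p)) ‖x‖ from rfl,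
    lintegral_comp_norm hn (hm.indicator hs)]
  congr 1
  rw [← lintegral_indicator hs, ← lintegral_indicator measurableSet_Ioi]
  refine lintegral_congr_ae ?_
  filter_upwards [(Set.countable_singleton (0 : ℝ)).ae_notMem volume] with r hr
  by_cases hrs : r ∈ s
  · have h0 : 0 < r := lt_of_le_of_ne (hs0 hrs) (Ne.symm hr)
    rw [Set.indicator_of_mem (Set.mem_Ioi.mpr h0), Set.indicator_of_mem hrs,
      Set.indicator_of_mem hrs, ← ENNReal.ofReal_mul (by positivity), ← Real.rpow_natCast,
      ← Real.rpow_add h0, Nat.cast_sub hn]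
    congr 2
    push_cast
    ring
  · rw [Set.indicator_of_notMem hrs]
    by_cases h0 : r ∈ Set.Ioi (0 : ℝ)
    · rw [Set.indicator_of_mem h0, Set.indicator_of_notMem hrs, mul_zero]
    · rw [Set.indicator_of_notMem h0]

open MeasureTheory Measure in
theorem lintegral_Ico_rpow_of_gt {q R : ℝ} (hq : -1 < q) (hR : 0 ≤ R) :
    ∫⁻ r in Set.Ico 0 R, ENNReal.ofReal (r ^ q) = ENNReal.ofReal (R ^ (q + 1) / (q + 1)) := by
  rw [restrict_congr_set Ico_ae_eq_Ioc, ← ofReal_integral_eq_lintegral_ofReal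
      (intervalIntegral.intervalIntegrable_rpow' hq).1,
    ← intervalIntegral.integral_of_le hR, integral_rpow (Or.inl hq),
    Real.zero_rpow (by linarith), sub_zero]
  filter_upwards [ae_restrict_mem measurableSet_Ioc] with r hr using Real.rpow_nonneg hr.1.le q

open MeasureTheory Measure in
theorem lintegral_Ico_rpow_of_lt {q ρ : ℝ} (hq : q < -1) (h0 : 0 < ρ) (h1 : ρ ≤ 1) :
    ∫⁻ r in Set.Ico ρ 1, ENNReal.ofReal (r ^ q) ≤ ENNReal.ofReal (ρ ^ (q + 1) / (-(q + 1))) := by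
  have hmem : (0 : ℝ) ∉ Set.uIcc ρ 1 := by
    rw [Set.uIcc_of_le h1]; exact fun h => absurd h.1 (not_le.mpr h0)
  rw [restrict_congr_set Ico_ae_eq_Ioc, ← ofReal_integral_eq_lintegral_ofReal
      (intervalIntegral.intervalIntegrable_rpow (Or.inr hmem)).1,
    ← intervalIntegral.integral_of_le h1, integral_rpow (Or.inr ⟨hq.ne, hmem⟩)]
  · refine ENNReal.ofReal_le_ofReal ?_
    rw [Real.one_rpow, ← neg_div_neg_eq]
    have : 0 < -(q + 1) := by linarith
    gcongr
    linarith
  · filter_upwards [ae_restrict_mem measurableSet_Ioc] with r hr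
      using Real.rpow_nonneg (h0.le.trans hr.1.le) q

open MeasureTheory Measure in
theorem lintegral_Ico_rpow_neg_one {ρ : ℝ} (h0 : 0 < ρ) (h1 : ρ ≤ 1) :
    ∫⁻ r in Set.Ico ρ 1, ENNReal.ofReal (r ^ (-1 : ℝ)) = ENNReal.ofReal (-Real.log ρ) := by
  have hmem : (0 : ℝ) ∉ Set.uIcc ρ 1 := by
    rw [Set.uIcc_of_le h1]; exact fun h => absurd h.1 (not_le.mpr h0)
  rw [restrict_congr_set Ico_ae_eq_Ioc, ← ofReal_integral_eq_lintegral_ofReal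
      (intervalIntegral.intervalIntegrable_rpow (Or.inr hmem)).1,
    ← intervalIntegral.integral_of_le h1]
  · simp only [Real.rpow_neg_one]
    rw [integral_inv_of_pos h0 one_pos, one_div, Real.log_inv]
  · filter_upwards [ae_restrict_mem measurableSet_Ioc] with r hr
      using Real.rpow_nonneg (h0.le.trans hr.1.le) _

/-- The measure of the unit sphere. -/
noncomputable def sphereArea (n : ℕ) : ℝ :=
  n * (MeasureTheory.volume (Metric.ball (0 : Euc n) 1)).toReal

theorem sphereArea_pos {n : ℕ} (hn : 0 < n) : 0 < sphereArea n := by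
  have : 0 < (MeasureTheory.volume (Metric.ball (0 : Euc n) 1)).toReal :=
    ENNReal.toReal_pos (Metric.measure_ball_pos _ _ one_pos).ne' MeasureTheory.measure_ball_lt_top.ne
  have : (0 : ℝ) < n := by exact_mod_cast hn
  unfold sphereArea
  positivity

theorem ofReal_sphereArea (n : ℕ) : ENNReal.ofReal (sphereArea n) =
    n * MeasureTheory.volume (Metric.ball (0 : Euc n) 1) := by
  rw [sphereArea, ENNReal.ofReal_mul (by positivity),
    ENNReal.ofReal_toReal MeasureTheory.measure_ball_lt_top.ne, ENNReal.ofReal_natCast]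

theorem norm_preimage_Ico_zero {n : ℕ} (R : ℝ) :
    (norm ⁻¹' Set.Ico 0 R : Set (Euc n)) = Metric.ball 0 R := by
  ext x; simp

theorem lintegral_ball_norm_rpow {n : ℕ} (hn : 0 < n) {p R : ℝ} (hp : 0 < p + n) (hR : 0 ≤ R) :
    ∫⁻ x in Metric.ball (0 : Euc n) R, ENNReal.ofReal (‖x‖ ^ p) =
      ENNReal.ofReal (sphereArea n * (R ^ (p + n) / (p + n))) := by
  rw [← norm_preimage_Ico_zero, setLIntegral_norm_rpow hn measurableSet_Ico
    Set.Ico_subset_Ici_self, lintegral_Ico_rpow_of_gt (by linarith) hR, ← ofReal_sphereArea,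
    ← ENNReal.ofReal_mul (sphereArea_pos hn).le]
  simp

theorem lintegral_shell_norm_rpow_le {n : ℕ} (hn : 0 < n) {p ρ : ℝ} (hp : p + n < 0)
    (h0 : 0 < ρ) (h1 : ρ ≤ 1) :
    ∫⁻ x in (norm ⁻¹' Set.Ico ρ 1 : Set (Euc n)), ENNReal.ofReal (‖x‖ ^ p) ≤
      ENNReal.ofReal (sphereArea n * (ρ ^ (p + n) / (-(p + n)))) := by
  rw [setLIntegral_norm_rpow hn measurableSet_Ico
    (fun x hx => h0.le.trans hx.1), ← ofReal_sphereArea, ENNReal.ofReal_mul (sphereArea_pos hn).le]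
  gcongr
  refine (lintegral_Ico_rpow_of_lt (by linarith) h0 h1).trans_eq ?_
  simp

theorem lintegral_shell_norm_rpow_neg_dim {n : ℕ} (hn : 0 < n) {ρ : ℝ}
    (h0 : 0 < ρ) (h1 : ρ ≤ 1) :
    ∫⁻ x in (norm ⁻¹' Set.Ico ρ 1 : Set (Euc n)), ENNReal.ofReal (‖x‖ ^ (-n : ℝ)) =
      ENNReal.ofReal (sphereArea n * -Real.log ρ) := by
  rw [setLIntegral_norm_rpow hn measurableSet_Ico
    (fun x hx => h0.le.trans hx.1), ← ofReal_sphereArea, ENNReal.ofReal_mul (sphereArea_pos hn).le,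
    ← lintegral_Ico_rpow_neg_one h0 h1]
  simp

theorem lintegral_ball_norm_sub_rpow {n : ℕ} (hn : 0 < n) (a : Euc n) {p R : ℝ} (hp : 0 < p + n)
    (hR : 0 ≤ R) :
    ∫⁻ x in Metric.ball a R, ENNReal.ofReal (‖x - a‖ ^ p) =
      ENNReal.ofReal (sphereArea n * (R ^ (p + n) / (p + n))) := by
  rw [← lintegral_ball_norm_rpow hn hp hR, ← MeasureTheory.lintegral_indicator measurableSet_ball,
    ← MeasureTheory.lintegral_indicator measurableSet_ball,
    ← MeasureTheory.lintegral_sub_right_eq_self (Set.indicator (Metric.ball 0 R) _) a]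
  congr 1
  ext x
  simp [Set.indicator, dist_eq_norm]

/-! ### Dependence of the energy on the exponent, and part (i) -/

theorem weightedEnergy_radialProj_zero {n : ℕ} (hn : 2 ≤ n) {α : ℝ} (hα : 2 - n < α) :
    weightedEnergy α (radialProj (0 : Euc n)) =
      ENNReal.ofReal (sphereArea n * (n - 1) / (α + n - 2)) := by
  have hn0 : 0 < n := by omega
  have hn1 : (0 : ℝ) ≤ n - 1 := by
    have : (2 : ℝ) ≤ n := by exact_mod_cast hn
    linarith
  have : Nonempty (Fin n) := ⟨⟨0, hn0⟩⟩
  have h : ∀ᵐ x : Euc n ∂MeasureTheory.volume.restrict (Metric.ball (0 : Euc n) 1),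
      ENNReal.ofReal (‖x‖ ^ α * gradNormSq (radialProj 0) x) =
        ENNReal.ofReal (n - 1) * ENNReal.ofReal (‖x‖ ^ (α - 2)) := by
    filter_upwards [MeasureTheory.ae_restrict_of_ae
      ((Set.countable_singleton (0 : Euc n)).ae_notMem MeasureTheory.volume)] with x hx
    have hx' : 0 < ‖x‖ := norm_pos_iff.mpr hx
    rw [gradNormSq_radialProj_zero hx, ← ENNReal.ofReal_mul hn1, Real.rpow_sub hx']
    norm_num
    ring_nf
  rw [weightedEnergy, MeasureTheory.lintegral_congr_ae h,
    MeasureTheory.lintegral_const_mul' _ _ ENNReal.ofReal_ne_top,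
    lintegral_ball_norm_rpow hn0 (by linarith) zero_le_one, ← ENNReal.ofReal_mul hn1]
  congr 1
  rw [Real.one_rpow, show α - 2 + n = α + n - 2 by ring]
  ring

open MeasureTheory in
theorem ae_restrict_ball_ne {n : ℕ} (hn : 0 < n) (s : Set (Euc n)) (a : Euc n) :
    ∀ᵐ x : Euc n ∂volume.restrict s, x ≠ a := by
  have : Nonempty (Fin n) := ⟨⟨0, hn⟩⟩
  exact ae_restrict_of_ae ((Set.countable_singleton a).ae_notMem volume)

theorem weightedEnergy_anti {n : ℕ} (hn : 0 < n) (u : Euc n → Euc n) {α β : ℝ} (h : α ≤ β) :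
    weightedEnergy β u ≤ weightedEnergy α u := by
  refine MeasureTheory.lintegral_mono_ae ?_
  filter_upwards [ae_restrict_ball_ne hn (Metric.ball (0 : Euc n) 1) 0,
    MeasureTheory.ae_restrict_mem measurableSet_ball] with x hx hx1
  have hx' : 0 < ‖x‖ := norm_pos_iff.mpr hx
  have hx1' : ‖x‖ ≤ 1 := by simpa using (mem_ball_zero_iff.mp hx1).le
  exact ENNReal.ofReal_le_ofReal (mul_le_mul_of_nonneg_right
    (Real.rpow_le_rpow_of_exponent_ge hx' hx1' h) (gradNormSq_nonneg u x))

/-- The two singularities are split at `‖x‖ = ‖a‖/2`: inside, `‖x - a‖ ≥ ‖a‖/2`; outside, the weight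
is bounded. What remains is `‖x‖^(2-n)` or `‖x - a‖^(-2)`, both integrable for `n ≥ 3`. -/
theorem weightedEnergy_radialProj_lt_top {n : ℕ} (hn : 3 ≤ n) {a : Euc n} (ha : ‖a‖ < 1)
    (ha0 : a ≠ 0) : weightedEnergy (2 - n) (radialProj a) < ⊤ := by
  have hn0 : 0 < n := by omega
  have hn' : (3 : ℝ) ≤ n := by exact_mod_cast hn
  have ht : 0 < ‖a‖ := norm_pos_iff.mpr ha0
  set t := ‖a‖
  set C : ℝ := 4 * (n - 2 + 4 / (1 - t) ^ 2) with hC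
  have hC0 : 0 ≤ C := by
    have : 0 ≤ 4 / (1 - t) ^ 2 := by positivity
    rw [hC]; linarith
  have hpt : ∀ᵐ x : Euc n ∂MeasureTheory.volume.restrict (Metric.ball (0 : Euc n) 1),
      ENNReal.ofReal (‖x‖ ^ (2 - n : ℝ) * gradNormSq (radialProj a) x) ≤
        ENNReal.ofReal (C * (2 / t) ^ 2) * ENNReal.ofReal (‖x‖ ^ (2 - n : ℝ)) +
          ENNReal.ofReal (C * (t / 2) ^ (2 - n : ℝ)) * ENNReal.ofReal (‖x - a‖ ^ (-2 : ℝ)) := by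
    filter_upwards [ae_restrict_ball_ne hn0 (Metric.ball (0 : Euc n) 1) 0,
      ae_restrict_ball_ne hn0 (Metric.ball (0 : Euc n) 1) a] with x hx hxa
    have hr : 0 < ‖x‖ := norm_pos_iff.mpr hx
    have hR : 0 < ‖x - a‖ := norm_pos_iff.mpr (sub_ne_zero.mpr hxa)
    have hg := gradNormSq_radialProj_le (by omega) ha hxa
    rw [← ENNReal.ofReal_mul (by positivity), ← ENNReal.ofReal_mul (by positivity),
      ← ENNReal.ofReal_add (by positivity) (by positivity)]
    refine ENNReal.ofReal_le_ofReal ?_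
    have e : ‖x - a‖ ^ (-2 : ℝ) = 1 / ‖x - a‖ ^ 2 := by
      rw [Real.rpow_neg hR.le, one_div]; norm_num
    have h1 : ‖x‖ ^ (2 - n : ℝ) * gradNormSq (radialProj a) x ≤
        C * ‖x‖ ^ (2 - n : ℝ) * (1 / ‖x - a‖ ^ 2) := by
      calc _ ≤ ‖x‖ ^ (2 - n : ℝ) * (C / ‖x - a‖ ^ 2) := by gcongr
        _ = _ := by ring
    refine h1.trans ?_
    rw [e]
    rcases le_or_gt ‖x‖ (t / 2) with h | h
    · have hR2 : t / 2 ≤ ‖x - a‖ := by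
        have := norm_sub_norm_le a x
        rw [norm_sub_rev] at this
        linarith
      have h2 : 1 / ‖x - a‖ ^ 2 ≤ (2 / t) ^ 2 := by
        rw [show (2 / t) ^ 2 = 1 / (t / 2) ^ 2 by field_simp]
        gcongr
      have h3 : 0 ≤ C * (t / 2) ^ (2 - n : ℝ) * (1 / ‖x - a‖ ^ 2) := by positivity
      calc _ ≤ C * ‖x‖ ^ (2 - n : ℝ) * (2 / t) ^ 2 := by gcongr
        _ ≤ _ := by linarith
    · have h2 : ‖x‖ ^ (2 - n : ℝ) ≤ (t / 2) ^ (2 - n : ℝ) :=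
        Real.rpow_le_rpow_of_nonpos (by positivity) h.le (by linarith)
      have h3 : 0 ≤ C * (2 / t) ^ 2 * ‖x‖ ^ (2 - n : ℝ) := by positivity
      calc _ ≤ C * (t / 2) ^ (2 - n : ℝ) * (1 / ‖x - a‖ ^ 2) := by gcongr
        _ ≤ _ := by linarith
  refine (MeasureTheory.lintegral_mono_ae hpt).trans_lt ?_
  rw [MeasureTheory.lintegral_add_left (by fun_prop),
    MeasureTheory.lintegral_const_mul' _ _ ENNReal.ofReal_ne_top,
    MeasureTheory.lintegral_const_mul' _ _ ENNReal.ofReal_ne_top]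
  refine ENNReal.add_lt_top.mpr ⟨ENNReal.mul_lt_top ENNReal.ofReal_lt_top ?_,
    ENNReal.mul_lt_top ENNReal.ofReal_lt_top ?_⟩
  · rw [lintegral_ball_norm_rpow hn0 (by linarith) zero_le_one]
    exact ENNReal.ofReal_lt_top
  · refine (MeasureTheory.lintegral_mono_set (Metric.ball_subset_ball' (y := a) (ε₂ := 2) ?_)).trans_lt ?_
    · rw [dist_zero_left]; linarith
    · rw [lintegral_ball_norm_sub_rpow hn0 a (by linarith) (by norm_num)]
      exact ENNReal.ofReal_lt_top

/-- Near the critical exponent `2 - n`, the radial projection from the origin is beaten by the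
radial projection from any other point. -/
theorem exists_forall_weightedEnergy_lt {n : ℕ} (hn : 3 ≤ n) {a : Euc n} (ha : ‖a‖ < 1)
    (ha0 : a ≠ 0) : ∃ α₀ : ℝ, α₀ ∈ Set.Ioo (2 - (n : ℝ)) 0 ∧ ∀ α ∈ Set.Ioc (2 - (n : ℝ)) α₀,
      weightedEnergy α (radialProj a) < weightedEnergy α (radialProj (0 : Euc n)) := by
  have hn0 : 0 < n := by omega
  have hn' : (3 : ℝ) ≤ n := by exact_mod_cast hn
  have hfin := weightedEnergy_radialProj_lt_top hn ha ha0
  set e := (weightedEnergy (2 - n) (radialProj a)).toReal with he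
  have he0 : 0 ≤ e := ENNReal.toReal_nonneg
  have hM : 0 < sphereArea n * (n - 1) := mul_pos (sphereArea_pos hn0) (by linarith)
  set M := sphereArea n * (n - 1) with hMdef
  have hq : 0 < M / (e + 1) := by positivity
  -- `M / (e + 1)` makes the energy of `u_0`, namely `M / (α + n - 2)`, at least `e + 1`; the `1 /
  -- 2` keeps `α₀` negative.
  refine ⟨2 - n + min (1 / 2) (M / (e + 1)), ⟨?_, ?_⟩, ?_⟩
  · have : 0 < min (1 / 2) (M / (e + 1)) := lt_min (by norm_num) hq
    linarith
  · have := min_le_left (1 / 2) (M / (e + 1))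
    linarith
  · rintro α ⟨h1, h2⟩
    refine (weightedEnergy_anti hn0 _ h1.le).trans_lt ?_
    rw [weightedEnergy_radialProj_zero (by omega) h1, ← ENNReal.ofReal_toReal hfin.ne, ← he,
      ← hMdef]
    have h3 := min_le_right (1 / 2) (M / (e + 1))
    have h4 : 0 < α + n - 2 := by linarith
    have h5 : α + n - 2 ≤ M / (e + 1) := by linarith
    have h6 : e + 1 ≤ M / (α + n - 2) := by
      rw [le_div_iff₀ (by positivity)] at h5
      rw [le_div_iff₀ h4]
      linarith
    exact (ENNReal.ofReal_lt_ofReal_iff (by positivity)).mpr (by linarith)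

/-- A strict inequality of energies persists when the exponent increases slightly. -/
theorem exists_forall_weightedEnergy_lt_of_lt {n : ℕ} (hn : 2 ≤ n) {a : Euc n} {β : ℝ}
    (hβ : 2 - n < β)
    (h : weightedEnergy β (radialProj a) < weightedEnergy β (radialProj (0 : Euc n))) :
    ∃ α₀ ∈ Set.Ioo β (β + 1), ∀ α ∈ Set.Ioo β α₀,
      weightedEnergy α (radialProj a) < weightedEnergy α (radialProj (0 : Euc n)) := by
  have hcont : Filter.Tendsto (fun α : ℝ => ENNReal.ofReal (sphereArea n * (n - 1) / (α + n - 2)))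
      (nhds β) (nhds (ENNReal.ofReal (sphereArea n * (n - 1) / (β + n - 2)))) := by
    refine ENNReal.tendsto_ofReal (ContinuousAt.tendsto (f := fun α : ℝ => _ / (α + n - 2)) ?_)
    exact continuousAt_const.div (by fun_prop) (by linarith)
  rw [weightedEnergy_radialProj_zero hn hβ] at h
  obtain ⟨ε, hε, hball⟩ := Metric.eventually_nhds_iff.mp (hcont.eventually_const_lt h)
  refine ⟨β + min (1 / 2) ε, ⟨?_, ?_⟩, ?_⟩
  · have : 0 < min (1 / 2) ε := lt_min (by norm_num) hε
    linarith
  · have := min_le_left (1 / 2) ε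
    linarith
  · rintro α ⟨h1, h2⟩
    -- Only the energy of `u_0` needs continuity in the exponent; that of `u_a` can only decrease.
    refine (weightedEnergy_anti (by omega) _ h1.le).trans_lt ?_
    rw [weightedEnergy_radialProj_zero hn (hβ.trans h1)]
    refine hball ?_
    have := min_le_right (1 / 2) ε
    rw [Real.dist_eq, abs_of_pos (by linarith)]
    linarith

/-! ### Second-order expansion, averaged over a cross-polytope -/

/-- With `z = q²/p²` the left side is `(2/p)/(1 - z)`, and `1/(1 - z) ≤ 1 + z + 2z²` for `0 ≤ z ≤
1/2`. -/
theorem inv_sub_add_inv_add_le {p q : ℝ} (hp : 0 < p) (hq : 2 * |q| ≤ p) :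
    1 / (p - q) + 1 / (p + q) ≤ 2 / p + 2 * q ^ 2 / p ^ 3 + 4 * q ^ 4 / p ^ 5 := by
  have h1 := abs_le.mp (show |q| ≤ p / 2 by linarith)
  have hpq : 0 < p - q := by linarith
  have hpq' : 0 < p + q := by linarith
  have hsq : 2 * q ^ 2 ≤ p ^ 2 := by nlinarith [mul_pos hpq hpq']
  rw [div_add_div _ _ hpq.ne' hpq'.ne', div_le_iff₀ (by positivity)]
  have e : (2 / p + 2 * q ^ 2 / p ^ 3 + 4 * q ^ 4 / p ^ 5) * ((p - q) * (p + q)) =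
      2 * p + 2 * q ^ 4 / p ^ 5 * (p ^ 2 - 2 * q ^ 2) := by
    field_simp
    ring
  rw [e]
  have : 0 ≤ 2 * q ^ 4 / p ^ 5 * (p ^ 2 - 2 * q ^ 2) :=
    mul_nonneg (by positivity) (by linarith)
  linarith

/-- Second-order expansion of `‖x - a‖⁻² + ‖x + a‖⁻²` with `y = ⟨a, x⟩`. In the remainder, `66 = 2 +
64`: the 2 comes from expanding `2/(r² + t²)`, the 64 from the quartic term in `2y`. -/
theorem inv_sub_add_inv_add_norm_le {r t y : ℝ} (ht : 0 < t) (hr : 4 * t ≤ r)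
    (hy : |y| ≤ t * r) :
    1 / (r ^ 2 + t ^ 2 - 2 * y) + 1 / (r ^ 2 + t ^ 2 + 2 * y) ≤
      2 / r ^ 2 - 2 * t ^ 2 / r ^ 4 + 8 * y ^ 2 / r ^ 6 + 66 * t ^ 4 / r ^ 6 := by
  have hr0 : 0 < r := by linarith
  have hp : 0 < r ^ 2 + t ^ 2 := by positivity
  have hq : 2 * |2 * y| ≤ r ^ 2 + t ^ 2 := by
    rw [abs_mul, abs_two]
    nlinarith
  have hrp : r ^ 2 ≤ r ^ 2 + t ^ 2 := by nlinarith
  have h := inv_sub_add_inv_add_le hp hq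
  have h1 : 2 / (r ^ 2 + t ^ 2) ≤ 2 / r ^ 2 - 2 * t ^ 2 / r ^ 4 + 2 * t ^ 4 / r ^ 6 := by
    have e : 2 / r ^ 2 - 2 * t ^ 2 / r ^ 4 + 2 * t ^ 4 / r ^ 6 =
        2 / (r ^ 2 + t ^ 2) + 2 * t ^ 6 / (r ^ 6 * (r ^ 2 + t ^ 2)) := by
      field_simp
      ring
    rw [e]
    have : 0 ≤ 2 * t ^ 6 / (r ^ 6 * (r ^ 2 + t ^ 2)) := by positivity
    linarith
  have h2 : 2 * (2 * y) ^ 2 / (r ^ 2 + t ^ 2) ^ 3 ≤ 8 * y ^ 2 / r ^ 6 := by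
    calc _ ≤ 2 * (2 * y) ^ 2 / (r ^ 2) ^ 3 := by gcongr
      _ = _ := by ring
  have h3 : 4 * (2 * y) ^ 4 / (r ^ 2 + t ^ 2) ^ 5 ≤ 64 * t ^ 4 / r ^ 6 := by
    calc _ ≤ 4 * (2 * y) ^ 4 / (r ^ 2) ^ 5 := by gcongr
      _ = 64 * |y| ^ 4 / (r ^ 2) ^ 5 := by
        rw [show (2 * y) ^ 4 = 16 * y ^ 4 by ring, Even.pow_abs (by decide)]; ring
      _ ≤ 64 * (t * r) ^ 4 / (r ^ 2) ^ 5 := by gcongr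
      _ = _ := by field_simp
  have h4 : 66 * t ^ 4 / r ^ 6 = 2 * t ^ 4 / r ^ 6 + 64 * t ^ 4 / r ^ 6 := by ring
  rw [h4]
  linarith

/-- The gradients of the radial projections from two opposite points. -/
theorem gradNormSq_radialProj_add_neg_le {n : ℕ} (hn : 2 ≤ n) {a x : Euc n} (ha0 : a ≠ 0)
    (hx1 : ‖x‖ ≤ 1) (hx : 4 * ‖a‖ ≤ ‖x‖) :
    gradNormSq (radialProj a) x + gradNormSq (radialProj (-a)) x ≤
      (n - 1) * (2 / ‖x‖ ^ 2 - 2 * ‖a‖ ^ 2 / ‖x‖ ^ 4 + 8 * (inner ℝ a x) ^ 2 / ‖x‖ ^ 6 +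
        66 * ‖a‖ ^ 4 / ‖x‖ ^ 6) + 5 * (12 * n + 24) * ‖a‖ ^ 2 / ‖x‖ ^ 3 := by
  have ht : 0 < ‖a‖ := norm_pos_iff.mpr ha0
  have hr0 : 0 < ‖x‖ := by linarith
  have hn' : (2 : ℝ) ≤ n := by exact_mod_cast hn
  have hR1 : 3 / 4 * ‖x‖ ≤ ‖x - a‖ := by
    have := norm_sub_norm_le x a
    linarith
  have hR2 : 3 / 4 * ‖x‖ ≤ ‖x - -a‖ := by
    have := norm_sub_norm_le x (-a)
    rw [norm_neg] at this
    linarith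
  have hR1p : 0 < ‖x - a‖ := by linarith
  have hR2p : 0 < ‖x - -a‖ := by linarith
  have g1 := gradNormSq_radialProj_le_refined hn (a := a) (x := x) (by linarith) hx1
    (sub_ne_zero.mp (norm_pos_iff.mp hR1p))
  have g2 := gradNormSq_radialProj_le_refined hn (a := -a) (x := x) (by rw [norm_neg]; linarith) hx1
    (sub_ne_zero.mp (norm_pos_iff.mp hR2p))
  have s1 : ‖x - a‖ ^ 2 = ‖x‖ ^ 2 + ‖a‖ ^ 2 - 2 * inner ℝ a x := by
    rw [norm_sub_sq_real, real_inner_comm]; ring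
  have s2 : ‖x - -a‖ ^ 2 = ‖x‖ ^ 2 + ‖a‖ ^ 2 + 2 * inner ℝ a x := by
    rw [sub_neg_eq_add, norm_add_sq_real, real_inner_comm]; ring
  rw [norm_neg, inner_neg_left] at g2
  have hy : |inner ℝ a x| ≤ ‖a‖ * ‖x‖ := abs_real_inner_le_norm a x
  have hpair := inv_sub_add_inv_add_norm_le ht hx hy
  rw [← s1, ← s2] at hpair
  set y : ℝ := inner ℝ a x
  set P := ‖x - a‖
  set Q := ‖x - -a‖
  have hcube : ∀ z : ℝ, 3 / 4 * ‖x‖ ≤ z → (12 * n + 24) * ‖a‖ ^ 2 / z ^ 3 ≤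
      5 / 2 * ((12 * n + 24) * ‖a‖ ^ 2 / ‖x‖ ^ 3) := by
    intro z hz
    calc _ ≤ (12 * n + 24) * ‖a‖ ^ 2 / (3 / 4 * ‖x‖) ^ 3 := by gcongr
      _ = 64 / 27 * ((12 * n + 24) * ‖a‖ ^ 2 / ‖x‖ ^ 3) := by field_simp; norm_num
      _ ≤ _ := mul_le_mul_of_nonneg_right (by norm_num) (by positivity)
  have c1 := hcube P hR1
  have c2 := hcube Q hR2
  -- The odd terms need no expansion: `Q² - P² = 4y`, so their sum has a favourable sign and is
  -- dropped.
  have hodd : 0 ≤ 2 * y / P ^ 3 + 2 * -y / Q ^ 3 := by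
    have e : 2 * y / P ^ 3 + 2 * -y / Q ^ 3 = 2 * (y * (1 / P ^ 3 - 1 / Q ^ 3)) := by ring
    rw [e]
    refine mul_nonneg zero_le_two ?_
    rcases le_total 0 y with h | h
    · have : P ≤ Q := abs_le_of_sq_le_sq' (by linarith) hR2p.le |>.2
      refine mul_nonneg h (sub_nonneg.mpr ?_)
      gcongr
    · have : Q ≤ P := abs_le_of_sq_le_sq' (by linarith) hR1p.le |>.2
      refine mul_nonneg_of_nonpos_of_nonpos h (sub_nonpos.mpr ?_)
      gcongr
  have hm := mul_le_mul_of_nonneg_left (hpair.trans (le_add_of_nonneg_right hodd))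
    (by linarith : (0 : ℝ) ≤ n - 1)
  have e5 : 5 * (12 * n + 24) * ‖a‖ ^ 2 / ‖x‖ ^ 3 =
      2 * (5 / 2 * ((12 * n + 24) * ‖a‖ ^ 2 / ‖x‖ ^ 3)) := by ring
  rw [e5]
  have hm' : (n - 1) * (1 / P ^ 2 - 2 * y / P ^ 3) + (n - 1) * (1 / Q ^ 2 - 2 * -y / Q ^ 3) ≤
      (n - 1) * (2 / ‖x‖ ^ 2 - 2 * ‖a‖ ^ 2 / ‖x‖ ^ 4 + 8 * y ^ 2 / ‖x‖ ^ 6 +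
        66 * ‖a‖ ^ 4 / ‖x‖ ^ 6) := by linarith
  linarith

/-- The vectors of length `t` along the coordinate axes. -/
noncomputable def axisPoint {n : ℕ} (t : ℝ) (i : Fin n) : Euc n := EuclideanSpace.single i t

theorem norm_axisPoint {n : ℕ} {t : ℝ} (ht : 0 ≤ t) (i : Fin n) : ‖axisPoint t i‖ = t := by
  simp [axisPoint, abs_of_nonneg ht]

/-- The sum of the gradients over the vertices of a small cross-polytope. -/
theorem sum_gradNormSq_axisPoint_le {n : ℕ} (hn : 2 ≤ n) {t : ℝ} (ht : 0 < t) {x : Euc n}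
    (hx1 : ‖x‖ ≤ 1) (hx : 4 * t ≤ ‖x‖) :
    ∑ i : Fin n, (gradNormSq (radialProj (axisPoint t i)) x +
        gradNormSq (radialProj (-axisPoint t i)) x) + (n - 1) * (2 * n - 8) * t ^ 2 / ‖x‖ ^ 4 ≤
      2 * n * (n - 1) / ‖x‖ ^ 2 + 66 * n ^ 2 * t ^ 4 / ‖x‖ ^ 6 +
        5 * n * (12 * n + 24) * t ^ 2 / ‖x‖ ^ 3 := by
  have hn' : (2 : ℝ) ≤ n := by exact_mod_cast hn
  have hr0 : 0 < ‖x‖ := by linarith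
  have hin : ∀ i : Fin n, (inner ℝ (axisPoint t i) x : ℝ) = t * x i := by
    intro i; simp [axisPoint, EuclideanSpace.inner_single_left]
  have hterm : ∀ i : Fin n, gradNormSq (radialProj (axisPoint t i)) x +
      gradNormSq (radialProj (-axisPoint t i)) x ≤
      ((n - 1) * (2 / ‖x‖ ^ 2 - 2 * t ^ 2 / ‖x‖ ^ 4 + 66 * t ^ 4 / ‖x‖ ^ 6) +
        5 * (12 * n + 24) * t ^ 2 / ‖x‖ ^ 3) + (n - 1) * (8 * t ^ 2 / ‖x‖ ^ 6) * x i ^ 2 := by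
    intro i
    have hN := norm_axisPoint ht.le i
    have h := gradNormSq_radialProj_add_neg_le hn (a := axisPoint t i) (x := x)
      (norm_pos_iff.mp (by rw [hN]; exact ht)) hx1 (by rw [hN]; exact hx)
    rw [hN, hin] at h
    refine h.trans_eq ?_
    ring
  have hsum := Finset.sum_le_sum fun i (_ : i ∈ Finset.univ) => hterm i
  conv_rhs at hsum => rw [Finset.sum_add_distrib]
  -- Summing `⟨t eᵢ, x⟩²` gives `t²‖x‖²`, so the terms in `t²/‖x‖⁴` combine to `(n - 1)(8 - 2n)`.
  rw [← Finset.mul_sum, ← EuclideanSpace.real_norm_sq_eq,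
    Finset.sum_const, Finset.card_univ, Fintype.card_fin, nsmul_eq_mul] at hsum
  have e : n * ((n - 1) * (2 / ‖x‖ ^ 2 - 2 * t ^ 2 / ‖x‖ ^ 4 + 66 * t ^ 4 / ‖x‖ ^ 6) +
        5 * (12 * n + 24) * t ^ 2 / ‖x‖ ^ 3) + (n - 1) * (8 * t ^ 2 / ‖x‖ ^ 6) * ‖x‖ ^ 2 =
      2 * n * (n - 1) / ‖x‖ ^ 2 + 66 * (n * (n - 1)) * t ^ 4 / ‖x‖ ^ 6 +
        5 * n * (12 * n + 24) * t ^ 2 / ‖x‖ ^ 3 - (n - 1) * (2 * n - 8) * t ^ 2 / ‖x‖ ^ 4 := by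
    field_simp
    ring
  rw [e] at hsum
  have : 66 * (n * (n - 1)) * t ^ 4 / ‖x‖ ^ 6 ≤ 66 * n ^ 2 * t ^ 4 / ‖x‖ ^ 6 := by
    gcongr
    nlinarith
  linarith

/-! ### Integrated estimates at the exponent `4 - n` -/

/-- The energy near the origin of the radial projection from a point near the origin. -/
theorem lintegral_ball_gradNormSq_le {n : ℕ} (hn : 4 ≤ n) {a : Euc n} {t : ℝ} (hat : ‖a‖ = t)
    (ht : 0 < t) (ht2 : t ≤ 1 / 2) :
    ∫⁻ x in Metric.ball (0 : Euc n) (4 * t),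
        ENNReal.ofReal (‖x‖ ^ (4 - n : ℝ) * gradNormSq (radialProj a) x) ≤
      ENNReal.ofReal (sphereArea n * (82 * (n + 14) * t ^ 2)) := by
  have hn0 : 0 < n := by omega
  have hn' : (4 : ℝ) ≤ n := by exact_mod_cast hn
  have hS := sphereArea_pos hn0
  have ha1 : ‖a‖ < 1 := by linarith
  have hpt : ∀ᵐ x : Euc n ∂MeasureTheory.volume.restrict (Metric.ball (0 : Euc n) (4 * t)),
      ENNReal.ofReal (‖x‖ ^ (4 - n : ℝ) * gradNormSq (radialProj a) x) ≤
        ENNReal.ofReal (4 * (n + 14)) * (ENNReal.ofReal (‖x‖ ^ (2 - n : ℝ)) +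
          ENNReal.ofReal (‖x - a‖ ^ (2 - n : ℝ))) := by
    filter_upwards [ae_restrict_ball_ne hn0 (Metric.ball (0 : Euc n) (4 * t)) 0,
      ae_restrict_ball_ne hn0 (Metric.ball (0 : Euc n) (4 * t)) a] with x hx hxa
    have hr : 0 < ‖x‖ := norm_pos_iff.mpr hx
    have hR : 0 < ‖x - a‖ := norm_pos_iff.mpr (sub_ne_zero.mpr hxa)
    have hg := gradNormSq_radialProj_le (by omega) ha1 hxa
    have hC : 4 * (n - 2 + 4 / (1 - ‖a‖) ^ 2) ≤ (4 * (n + 14) : ℝ) := by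
      have : 4 / (1 - ‖a‖) ^ 2 ≤ 4 / (1 / 2) ^ 2 := by
        gcongr
        linarith
      norm_num at this
      linarith
    rw [← ENNReal.ofReal_add (by positivity) (by positivity), ← ENNReal.ofReal_mul (by positivity)]
    refine ENNReal.ofReal_le_ofReal ?_
    -- Both exponents are nonpositive, so replacing both bases by the smaller of `‖x‖` and `‖x - a‖`
    -- increases the product.
    have hmul : ‖x‖ ^ (4 - n : ℝ) * (1 / ‖x - a‖ ^ 2) ≤
        ‖x‖ ^ (2 - n : ℝ) + ‖x - a‖ ^ (2 - n : ℝ) := by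
      have h0 : ∀ z : ℝ, 0 < z → z ^ (2 - n : ℝ) = z ^ (4 - n : ℝ) * (1 / z ^ 2) := by
        intro z hz
        rw [show (2 - n : ℝ) = (4 - n) + (-2) by ring, Real.rpow_add hz, Real.rpow_neg hz.le,
          one_div]
        norm_num
      rcases le_total ‖x‖ ‖x - a‖ with h | h
      · have h1 : 0 ≤ ‖x - a‖ ^ (2 - n : ℝ) := by positivity
        calc _ ≤ ‖x‖ ^ (4 - n : ℝ) * (1 / ‖x‖ ^ 2) := by gcongr
          _ ≤ _ := by rw [← h0 _ hr]; linarith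
      · have h1 : 0 ≤ ‖x‖ ^ (2 - n : ℝ) := by positivity
        have h2 : ‖x‖ ^ (4 - n : ℝ) ≤ ‖x - a‖ ^ (4 - n : ℝ) :=
          Real.rpow_le_rpow_of_nonpos hR h (by linarith)
        calc _ ≤ ‖x - a‖ ^ (4 - n : ℝ) * (1 / ‖x - a‖ ^ 2) := by gcongr
          _ ≤ _ := by rw [← h0 _ hR]; linarith
    calc _ ≤ ‖x‖ ^ (4 - n : ℝ) * (4 * (n + 14) / ‖x - a‖ ^ 2) := by
          gcongr
          exact hg.trans (by gcongr)
      _ = 4 * (n + 14) * (‖x‖ ^ (4 - n : ℝ) * (1 / ‖x - a‖ ^ 2)) := by ring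
      _ ≤ _ := by gcongr
  refine (MeasureTheory.lintegral_mono_ae hpt).trans ?_
  rw [MeasureTheory.lintegral_const_mul' _ _ ENNReal.ofReal_ne_top,
    MeasureTheory.lintegral_add_left (by fun_prop)]
  have hsub : Metric.ball (0 : Euc n) (4 * t) ⊆ Metric.ball a (5 * t) :=
    Metric.ball_subset_ball' (by rw [dist_zero_left, hat]; linarith)
  have h2 : ∫⁻ x in Metric.ball (0 : Euc n) (4 * t), ENNReal.ofReal (‖x - a‖ ^ (2 - n : ℝ)) ≤ _ :=
    (MeasureTheory.lintegral_mono_set hsub).trans_eq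
      (lintegral_ball_norm_sub_rpow hn0 a (by linarith) (by positivity))
  rw [lintegral_ball_norm_rpow hn0 (by linarith) (by positivity)]
  have h3 : (2 - n + n : ℝ) = 2 := by ring
  rw [h3, Real.rpow_two] at h2 ⊢
  refine (mul_le_mul_right (add_le_add_right h2 _) _).trans ?_
  rw [← ENNReal.ofReal_add (by positivity) (by positivity), ← ENNReal.ofReal_mul (by positivity)]
  refine ENNReal.ofReal_le_ofReal (le_of_eq ?_)
  ring

theorem weightedEnergy_eq_add {n : ℕ} (α : ℝ) (u : Euc n → Euc n) {ρ : ℝ} (h0 : 0 < ρ)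
    (h1 : ρ ≤ 1) : weightedEnergy α u =
      (∫⁻ x in Metric.ball (0 : Euc n) ρ, ENNReal.ofReal (‖x‖ ^ α * gradNormSq u x)) +
      ∫⁻ x in (norm ⁻¹' Set.Ico ρ 1 : Set (Euc n)), ENNReal.ofReal (‖x‖ ^ α * gradNormSq u x) := by
  rw [weightedEnergy, ← norm_preimage_Ico_zero, ← norm_preimage_Ico_zero,
    ← MeasureTheory.lintegral_union (measurable_norm measurableSet_Ico), ← Set.preimage_union,
    Set.Ico_union_Ico_eq_Ico h0.le h1]
  exact Disjoint.preimage _ (Set.disjoint_left.mpr fun y hy hy' => absurd hy'.1 (not_le.mpr hy.2))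

/-- The second-order gain in the shell dominates logarithmically. -/
theorem sum_lintegral_shell_gradNormSq_le {n : ℕ} (hn : 4 ≤ n) {t : ℝ} (ht : 0 < t)
    (ht4 : 4 * t ≤ 1) :
    ∑ i : Fin n,
        ((∫⁻ x in (norm ⁻¹' Set.Ico (4 * t) 1 : Set (Euc n)),
            ENNReal.ofReal (‖x‖ ^ (4 - n : ℝ) * gradNormSq (radialProj (axisPoint t i)) x)) +
          ∫⁻ x in (norm ⁻¹' Set.Ico (4 * t) 1 : Set (Euc n)),
            ENNReal.ofReal (‖x‖ ^ (4 - n : ℝ) * gradNormSq (radialProj (-axisPoint t i)) x)) +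
      ENNReal.ofReal (sphereArea n * ((n - 1) * (2 * n - 8) * t ^ 2 * -Real.log (4 * t))) ≤
    ENNReal.ofReal (sphereArea n *
      (n * (n - 1) + (66 * n ^ 2 + 5 * n * (12 * n + 24)) * t ^ 2)) := by
  have hn0 : 0 < n := by omega
  have hn' : (4 : ℝ) ≤ n := by exact_mod_cast hn
  have hS := sphereArea_pos hn0
  set s : Set (Euc n) := norm ⁻¹' Set.Ico (4 * t) 1 with hs
  have hms : MeasurableSet s := measurable_norm measurableSet_Ico
  have hmeas : ∀ a : Euc n, Measurable fun x : Euc n =>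
      ENNReal.ofReal (‖x‖ ^ (4 - n : ℝ) * gradNormSq (radialProj a) x) := fun a =>
    ((measurable_norm.pow_const _).mul (measurable_gradNormSq _)).ennreal_ofReal
  have hc0 : (0 : ℝ) ≤ (n - 1) * (2 * n - 8) * t ^ 2 :=
    mul_nonneg (mul_nonneg (by linarith) (by linarith)) (sq_nonneg t)
  -- The gain is added on the left to avoid truncated subtraction. Its weighted power is exactly
  -- `‖x‖^(-n)`, the one whose shell integral is logarithmic.
  have hpt : ∀ x ∈ s,
      ∑ i : Fin n, (ENNReal.ofReal (‖x‖ ^ (4 - n : ℝ) * gradNormSq (radialProj (axisPoint t i)) x) +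
          ENNReal.ofReal (‖x‖ ^ (4 - n : ℝ) * gradNormSq (radialProj (-axisPoint t i)) x)) +
        ENNReal.ofReal ((n - 1) * (2 * n - 8) * t ^ 2) * ENNReal.ofReal (‖x‖ ^ (-n : ℝ)) ≤
      ENNReal.ofReal (2 * n * (n - 1)) * ENNReal.ofReal (‖x‖ ^ (2 - n : ℝ)) +
        (ENNReal.ofReal (66 * n ^ 2 * t ^ 4) * ENNReal.ofReal (‖x‖ ^ (-2 - n : ℝ)) +
        ENNReal.ofReal (5 * n * (12 * n + 24) * t ^ 2) * ENNReal.ofReal (‖x‖ ^ (1 - n : ℝ))) := by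
    intro x hx
    have hr : 0 < ‖x‖ := lt_of_lt_of_le (by positivity) hx.1
    have h := mul_le_mul_of_nonneg_left
      (sum_gradNormSq_axisPoint_le (n := n) (by omega) ht hx.2.le hx.1)
      (Real.rpow_nonneg hr.le (4 - n : ℝ))
    have hn1 : (0 : ℝ) ≤ n - 1 := by linarith
    have hW : ∀ k : ℕ, ‖x‖ ^ (4 - n : ℝ) / ‖x‖ ^ k = ‖x‖ ^ (4 - n - k : ℝ) := fun k => by
      rw [Real.rpow_sub hr (4 - n) k, Real.rpow_natCast]
    have e4 : ‖x‖ ^ (-n : ℝ) = ‖x‖ ^ (4 - n : ℝ) / ‖x‖ ^ 4 := by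
      rw [hW]; congr 1; push_cast; ring
    have e2 : ‖x‖ ^ (2 - n : ℝ) = ‖x‖ ^ (4 - n : ℝ) / ‖x‖ ^ 2 := by
      rw [hW]; congr 1; push_cast; ring
    have e6 : ‖x‖ ^ (-2 - n : ℝ) = ‖x‖ ^ (4 - n : ℝ) / ‖x‖ ^ 6 := by
      rw [hW]; congr 1; push_cast; ring
    have e3 : ‖x‖ ^ (1 - n : ℝ) = ‖x‖ ^ (4 - n : ℝ) / ‖x‖ ^ 3 := by
      rw [hW]; congr 1; push_cast; ring
    have hg := fun a : Euc n => mul_nonneg (Real.rpow_nonneg hr.le (4 - n : ℝ))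
      (gradNormSq_nonneg (radialProj a) x)
    simp_rw [← ENNReal.ofReal_add (hg _) (hg _)]
    rw [← ENNReal.ofReal_sum_of_nonneg fun i _ => add_nonneg (hg _) (hg _),
      ← ENNReal.ofReal_mul hc0, ← ENNReal.ofReal_mul (by positivity),
      ← ENNReal.ofReal_mul (by positivity), ← ENNReal.ofReal_mul (by positivity),
      ← ENNReal.ofReal_add (Finset.sum_nonneg fun i _ => add_nonneg (hg _) (hg _))
        (mul_nonneg hc0 (by positivity)), ← ENNReal.ofReal_add (by positivity) (by positivity),
      ← ENNReal.ofReal_add (by positivity) (by positivity)]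
    refine ENNReal.ofReal_le_ofReal ?_
    simp_rw [← mul_add]
    rw [← Finset.mul_sum, e4, e2, e6, e3]
    calc _ = _ := by ring
      _ ≤ _ := h
      _ = _ := by ring
  have hint := MeasureTheory.setLIntegral_mono' (μ := MeasureTheory.volume) hms hpt
  have hlog : 0 ≤ -Real.log (4 * t) := by
    have := Real.log_nonpos (by positivity) ht4
    linarith
  have hn1 : (0 : ℝ) ≤ n - 1 := by linarith
  rw [MeasureTheory.lintegral_add_right _ (by fun_prop),
    MeasureTheory.lintegral_finsetSum _ fun i _ => by exact (hmeas _).add (hmeas _),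
    MeasureTheory.lintegral_const_mul' _ _ ENNReal.ofReal_ne_top, hs,
    lintegral_shell_norm_rpow_neg_dim hn0 (by positivity) ht4, ← ENNReal.ofReal_mul hc0, ← hs]
    at hint
  simp_rw [MeasureTheory.lintegral_add_left (hmeas _)] at hint
  rw [show sphereArea n * ((n - 1) * (2 * n - 8) * t ^ 2 * -Real.log (4 * t)) =
    (n - 1) * (2 * n - 8) * t ^ 2 * (sphereArea n * -Real.log (4 * t)) by ring]
  refine hint.trans ?_
  rw [MeasureTheory.lintegral_add_left (by fun_prop), MeasureTheory.lintegral_add_left (by fun_prop),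
    MeasureTheory.lintegral_const_mul' _ _ ENNReal.ofReal_ne_top,
    MeasureTheory.lintegral_const_mul' _ _ ENNReal.ofReal_ne_top,
    MeasureTheory.lintegral_const_mul' _ _ ENNReal.ofReal_ne_top]
  have hsub : s ⊆ Metric.ball (0 : Euc n) 1 := fun x hx => mem_ball_zero_iff.mpr hx.2
  have i2 : ∫⁻ x in s, ENNReal.ofReal (‖x‖ ^ (2 - n : ℝ)) ≤ ENNReal.ofReal (sphereArea n / 2) := by
    refine (MeasureTheory.lintegral_mono_set hsub).trans_eq ?_
    rw [lintegral_ball_norm_rpow hn0 (by linarith) zero_le_one]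
    congr 1
    rw [Real.one_rpow]
    ring
  have i1 : ∫⁻ x in s, ENNReal.ofReal (‖x‖ ^ (1 - n : ℝ)) ≤ ENNReal.ofReal (sphereArea n) := by
    refine (MeasureTheory.lintegral_mono_set hsub).trans_eq ?_
    rw [lintegral_ball_norm_rpow hn0 (by linarith) zero_le_one]
    congr 1
    rw [Real.one_rpow]
    ring
  have i6 : ∫⁻ x in s, ENNReal.ofReal (‖x‖ ^ (-2 - n : ℝ)) ≤
      ENNReal.ofReal (sphereArea n / t ^ 2) := by
    refine (lintegral_shell_norm_rpow_le hn0 (by linarith) (by positivity) ht4).trans ?_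
    refine ENNReal.ofReal_le_ofReal ?_
    have e : (4 * t) ^ (-2 - n + n : ℝ) = 1 / (4 * t) ^ 2 := by
      rw [show (-2 - n + n : ℝ) = -2 by ring, Real.rpow_neg (by positivity), one_div]
      norm_num
    rw [e, show (-(-2 - n + n) : ℝ) = 2 by ring,
      show sphereArea n * (1 / (4 * t) ^ 2 / 2) = 1 / 32 * (sphereArea n / t ^ 2) by
        field_simp; norm_num]
    have : 0 ≤ sphereArea n / t ^ 2 := by positivity
    linarith
  calc _ ≤ ENNReal.ofReal (2 * n * (n - 1)) * ENNReal.ofReal (sphereArea n / 2) +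
        (ENNReal.ofReal (66 * n ^ 2 * t ^ 4) * ENNReal.ofReal (sphereArea n / t ^ 2) +
        ENNReal.ofReal (5 * n * (12 * n + 24) * t ^ 2) * ENNReal.ofReal (sphereArea n)) := by gcongr
    _ = _ := by
      rw [← ENNReal.ofReal_mul (by positivity), ← ENNReal.ofReal_mul (by positivity),
        ← ENNReal.ofReal_mul (by positivity), ← ENNReal.ofReal_add (by positivity) (by positivity),
        ← ENNReal.ofReal_add (by positivity) (by positivity)]
      congr 1
      field_simp

/-! ### Comparison at the exponent `4 - n`, and conclusion -/

/-- At the exponent `4 - n`, the radial projection from the origin does not minimize the energy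
among radial projections. -/
theorem exists_weightedEnergy_four_sub_lt {n : ℕ} (hn : 5 ≤ n) :
    ∃ a : Euc n, ‖a‖ < 1 ∧
      weightedEnergy (4 - n) (radialProj a) < weightedEnergy (4 - n) (radialProj (0 : Euc n)) := by
  have hn0 : 0 < n := by omega
  have hn' : (5 : ℝ) ≤ n := by exact_mod_cast hn
  have hn1 : (0 : ℝ) ≤ n - 1 := by linarith
  have hS := sphereArea_pos hn0
  -- `D` collects all `t²` error coefficients: the shell errors, then the inner ball for each of the
  -- `2n` vertices. The choice of `t` makes the logarithm equal to `D`.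
  set D : ℝ := 66 * n ^ 2 + 5 * n * (12 * n + 24) + 2 * n * (82 * (n + 14)) with hD
  have hD0 : 0 < D := by positivity
  set t : ℝ := Real.exp (-D) / 4 with htdef
  have ht : 0 < t := by positivity
  have ht4 : 4 * t ≤ 1 := by
    have := Real.exp_le_one_iff.mpr (neg_nonpos.mpr hD0.le)
    rw [htdef]; linarith
  have hlog : -Real.log (4 * t) = D := by
    rw [htdef, mul_div_cancel₀ _ (by norm_num), Real.log_exp, neg_neg]
  by_contra! hcon
  have hlow : ENNReal.ofReal (sphereArea n * (n * (n - 1))) ≤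
      ∑ i : Fin n, (weightedEnergy (4 - n) (radialProj (axisPoint t i)) +
        weightedEnergy (4 - n) (radialProj (-axisPoint t i))) := by
    have hE : weightedEnergy (4 - n) (radialProj (0 : Euc n)) =
        ENNReal.ofReal (sphereArea n * (n - 1) / 2) := by
      rw [weightedEnergy_radialProj_zero (by omega) (by linarith)]
      congr 2
      ring
    have hterm : ∀ i : Fin n, ENNReal.ofReal (sphereArea n * (n - 1)) ≤
        weightedEnergy (4 - n) (radialProj (axisPoint t i)) +
        weightedEnergy (4 - n) (radialProj (-axisPoint t i)) := by
      intro i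
      have hN : ‖axisPoint t i‖ < 1 := by rw [norm_axisPoint ht.le]; linarith
      rw [show sphereArea n * (n - 1) = sphereArea n * (n - 1) / 2 + sphereArea n * (n - 1) / 2 by
        ring, ENNReal.ofReal_add (by positivity) (by positivity), ← hE]
      exact add_le_add (hcon _ hN) (hcon _ (by rwa [norm_neg]))
    refine le_trans (le_of_eq ?_) (Finset.sum_le_sum fun i _ => hterm i)
    rw [Finset.sum_const, Finset.card_univ, Fintype.card_fin, nsmul_eq_mul,
      ← ENNReal.ofReal_natCast, ← ENNReal.ofReal_mul (by positivity)]
    congr 1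
    ring
  have hin : ∀ i : Fin n, ∀ a : Euc n, a = axisPoint t i ∨ a = -axisPoint t i →
      weightedEnergy (4 - n) (radialProj a) ≤
      ENNReal.ofReal (sphereArea n * (82 * (n + 14) * t ^ 2)) +
        ∫⁻ x in (norm ⁻¹' Set.Ico (4 * t) 1 : Set (Euc n)),
            ENNReal.ofReal (‖x‖ ^ (4 - n : ℝ) * gradNormSq (radialProj a) x) := by
    intro i a ha
    have hN : ‖a‖ = t := by
      rcases ha with rfl | rfl <;> simp [norm_axisPoint ht.le]
    rw [weightedEnergy_eq_add _ _ (by positivity) ht4]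
    gcongr
    exact lintegral_ball_gradNormSq_le (by omega) hN ht (by linarith)
  have hup := hlow.trans (Finset.sum_le_sum fun i _ => add_le_add
    (hin i _ (Or.inl rfl)) (hin i _ (Or.inr rfl)))
  simp_rw [add_add_add_comm] at hup
  rw [Finset.sum_add_distrib] at hup
  have hshell := sum_lintegral_shell_gradNormSq_le (n := n) (by omega) ht ht4
  rw [hlog] at hshell
  have hneg0 : (0 : ℝ) ≤ (n - 1) * (2 * n - 8) * t ^ 2 * D :=
    mul_nonneg (mul_nonneg (mul_nonneg hn1 (by linarith)) (sq_nonneg t)) hD0.le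
  have hfinal := (add_le_add_left hup
    (ENNReal.ofReal (sphereArea n * ((n - 1) * (2 * n - 8) * t ^ 2 * D)))).trans
    ((add_assoc _ _ _).le.trans (add_le_add_right hshell _))
  rw [Finset.sum_const, Finset.card_univ, Fintype.card_fin, nsmul_eq_mul,
    ← ENNReal.ofReal_natCast, ← ENNReal.ofReal_add (by positivity) (mul_nonneg hS.le hneg0),
    ← ENNReal.ofReal_add (by positivity) (by positivity), ← ENNReal.ofReal_mul (by positivity),
    ← ENNReal.ofReal_add (by positivity) (by positivity),
    ENNReal.ofReal_le_ofReal_iff (by positivity)] at hfinal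
  -- The main terms `n(n - 1)` cancel, leaving gain at most error. This is absurd because the factor
  -- `(n - 1)(2n - 8)` exceeds 1.
  have hfin2 : sphereArea n * t ^ 2 * D * ((n - 1) * (2 * n - 8)) ≤ sphereArea n * t ^ 2 * D := by
    rw [hD] at hfinal ⊢
    linarith
  have hpos : 0 < sphereArea n * t ^ 2 * D := by positivity
  have hfac : (2 : ℝ) ≤ (n - 1) * (2 * n - 8) := by nlinarith
  have := le_of_mul_le_mul_left (hfin2.trans_eq (mul_one _).symm) hpos
  linarith

theorem theorem0p3 (n : ℕ) (hn : 3 ≤ n) :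
    (∀ a : Euc n, a ∈ Metric.ball (0 : Euc n) 1 → a ≠ 0 →
      ∃ α₀ : ℝ, α₀ ∈ Set.Ioo (2 - (n : ℝ)) 0 ∧
        ∀ α : ℝ, α ∈ Set.Ioc (2 - (n : ℝ)) α₀ →
          weightedEnergy α (radialProj a) < weightedEnergy α (radialProj (0 : Euc n))) ∧
    (6 ≤ n →
      ∃ α₀ : ℝ, α₀ ∈ Set.Ioo (4 - (n : ℝ)) (5 - (n : ℝ)) ∧
        ∀ α : ℝ, α ∈ Set.Ioo (4 - (n : ℝ)) α₀ →
          ∃ a : Euc n, a ∈ Metric.ball (0 : Euc n) 1 ∧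
            weightedEnergy α (radialProj a) < weightedEnergy α (radialProj (0 : Euc n))) := by
  refine ⟨fun a ha ha0 => exists_forall_weightedEnergy_lt hn (mem_ball_zero_iff.mp ha) ha0,
    fun hn6 => ?_⟩
  obtain ⟨a, ha, h⟩ := exists_weightedEnergy_four_sub_lt (n := n) (by omega)
  obtain ⟨α₀, hα₀, hlt⟩ := exists_forall_weightedEnergy_lt_of_lt (by omega) (by linarith) h
  exact ⟨α₀, ⟨hα₀.1, hα₀.2.trans_eq (by ring)⟩,
    fun α hα => ⟨a, mem_ball_zero_iff.mpr ha, hlt α hα⟩⟩
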